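/- **Underdamped Langevin mixing time.** Let $\Sigma_*\in\mathbb{R}^{d\times d}$ be symmetric positive definite, $\Sigma_*^{-1}=P\,\mathrm{diag}(s_1,\dots,s_d)P^{T}$ with $P$ orthogonal and $s_1\ge\dots\ge s_d>0$, and assume $s_1>1>s_d$. Put $f(x)=\tfrac12x^{T}\Sigma_*^{-1}x$, $\kappa=s_1/s_d$, $\gamma=2\sqrt{s_d}$ and $h=\sqrt{s_d}/s_1$. Consider the Euler–Maruyama scheme with step size $h$ of the underdamped Langevin dynamics ($a=0$), $$x_{k+1}=x_k+h\,p_k,\qquad p_{k+1}=p_k-h\nabla f(x_k)-h\gamma p_k+\sqrt{2\gamma h}\,z_k,$$ where $(x_0,p_0)\sim\mathcal N(0,\mathbf I_{2d\times 2d})$ and the $z_k\sim\mathcal N(0,\mathbf I_{d\times d})$ are independent of each other and of $(x_0,p_0)$. Let $\rho_k$ be the law of $x_k$, and let $\tilde\pi=\mathcal N\big(0,P\,\mathrm{diag}(y_1,\dots,y_d)P^{T}\big)$ be the biased target, where $$y_i=\frac1{s_i}\Big(1-\frac{hs_i\,(4+h(hs_i-\gamma))}{(hs_i-\gamma)\,(4+h(hs_i-2\gamma))}\Big).$$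 With $\mathrm{TV}(\mu,\nu)=\sup_A|\mu(A)-\nu(A)|$, the supremum being over measurable sets $A$, one has $\mathrm{TV}(\rho_k,\tilde\pi)\to0$ as $k\to\infty$. Moreover, there is a universal constant $C>0$ (independent of $d$, $\Sigma_*$ and $\delta$) such that for every $\delta\in(0,1)$ the mixing time $t_{\mathrm{mix}}(\delta)=\min\{k:\mathrm{TV}(\rho_k,\tilde\pi)\le\delta\}$ exists and satisfies $$t_{\mathrm{mix}}(\delta)\le C\,\frac{\log\kappa+\log(1/\delta)+\log d}{1/\kappa}.$$ -/

import Mathlib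

open MeasureTheory ProbabilityTheory Filter Topology Matrix

noncomputable section

/-- The total variation distance `sup_A |μ(A) - ν(A)|`, the supremum being over all measurable
sets `A`. -/
def tvDist {α : Type*} [MeasurableSpace α] (μ ν : Measure α) : ℝ :=
  ⨆ A : {A : Set α // MeasurableSet A}, |μ.real A.1 - ν.real A.1|

/-- `N` is the discrete `δ`-mixing time of the sequence of laws `ρ k` towards `ν`: the least `k` with
`TV(ρ k, ν) ≤ δ`. -/
def IsMixingTime {α : Type*} [MeasurableSpace α] (ρ : ℕ → Measure α) (ν : Measure α) (δ : ℝ)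
    (N : ℕ) : Prop :=
  IsLeast {k : ℕ | tvDist (ρ k) ν ≤ δ} N

/-- The quadratic potential `f(x) = (1/2) xᵀ Σ⁻¹ x` of the centred Gaussian with covariance
matrix `Σ` (written `S`). -/
def quadPotential {d : ℕ} (S : Matrix (Fin d) (Fin d) ℝ) (x : EuclideanSpace ℝ (Fin d)) : ℝ :=
  (1 / 2) * (x.ofLp ⬝ᵥ (S⁻¹ *ᵥ x.ofLp))

/-- One Euler–Maruyama step, with step size `h`, of gradient-adjusted underdamped Langevin dynamics
for the potential `f`, from the point `X = (x, p)`, with noise `z = (z₁, z₂)`: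
`x' = x - a h ∇f(x) + h p + √(2 a h) z₁` and `p' = p - h ∇f(x) - γ h p + √(2 γ h) z₂`.
For `a = 0` it is underdamped Langevin dynamics. -/
def eulerMaruyamaStep {d : ℕ} (f : EuclideanSpace ℝ (Fin d) → ℝ) (a γ h : ℝ)
    (X z : EuclideanSpace ℝ (Fin d) × EuclideanSpace ℝ (Fin d)) :
    EuclideanSpace ℝ (Fin d) × EuclideanSpace ℝ (Fin d) :=
  (X.1 - (a * h) • gradient f X.1 + h • X.2 + √(2 * a * h) • z.1,
   X.2 - h • gradient f X.1 - (γ * h) • X.2 + √(2 * γ * h) • z.2)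

/-- The standard Gaussian law `N(0, I)` of a pair of vectors of `ℝ^d`. -/
def stdGaussianPair (d : ℕ) : Measure (EuclideanSpace ℝ (Fin d) × EuclideanSpace ℝ (Fin d)) :=
  (stdGaussian (EuclideanSpace ℝ (Fin d))).prod (stdGaussian (EuclideanSpace ℝ (Fin d)))

/-- The operator on laws of the Euler–Maruyama scheme: the law of the step from `X ∼ μ` with an
independent standard Gaussian noise. -/
def eulerMaruyamaOp {d : ℕ} (f : EuclideanSpace ℝ (Fin d) → ℝ) (a γ h : ℝ)
    (μ : Measure (EuclideanSpace ℝ (Fin d) × EuclideanSpace ℝ (Fin d))) :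
    Measure (EuclideanSpace ℝ (Fin d) × EuclideanSpace ℝ (Fin d)) :=
  (μ.prod (stdGaussianPair d)).map fun Xz => eulerMaruyamaStep f a γ h Xz.1 Xz.2

/-- The law of the position `x_k` after `k` iterations of the Euler–Maruyama scheme started from
`(x_0, p_0) ∼ N(0, I)`. -/
def positionLaw {d : ℕ} (f : EuclideanSpace ℝ (Fin d) → ℝ) (a γ h : ℝ) (k : ℕ) :
    Measure (EuclideanSpace ℝ (Fin d)) :=
  ((eulerMaruyamaOp f a γ h)^[k] (stdGaussianPair d)).fst

/-- The variance of the biased target in the direction of an eigenvector of `Σ⁻¹` with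
eigenvalue `s`. -/
def biasedVariance (a γ h s : ℝ) : ℝ :=
  (1 / s) * (1 - h * s * (4 + (h + a * (h * γ - 2)) * (h * s - γ + a * s * (h * γ - 1))) /
    ((h * s - γ + a * s * (h * γ - 1)) * (4 + h * (h * s - 2 * γ + a * s * (h * γ - 2)))))

/-- The biased target: the centred Gaussian whose covariance matrix is diagonal in the orthonormal
basis of the columns of `P`, with the entries `biasedVariance a γ h (s i)`. -/
def biasedTarget {d : ℕ} (P : Matrix (Fin d) (Fin d) ℝ) (s : Fin d → ℝ) (a γ h : ℝ) :
    Measure (EuclideanSpace ℝ (Fin d)) :=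
  multivariateGaussian 0 (P * diagonal (fun i => biasedVariance a γ h (s i)) * Pᵀ)

end

/-! In an eigenbasis of `S⁻¹` the scheme splits into `d` independent linear recursions for a pair
`(x, p)`, so every law is a centred Gaussian diagonalised by `P` and only variances have to be
followed. Write `σ ^ 2 = s_d`, so the friction is `2 σ`. On test coefficients `(u, v)` one step is
`(1 - h σ) + h N` with `N (u, v) = (σ u - s v, u - σ v)` and `N ^ 2 = σ ^ 2 - s ≤ 0`. Its
eigenvalues are therefore complex (or a double real one) of squared modulus `1 - 2 h σ + h ^ 2 s`.
Since `h s ≤ σ`, this is at most `1 - h σ = 1 - 1 / κ`: the rate is `1 / κ` in every direction.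

The variance after `k` steps is the stationary one plus the initial defect evaluated at the `k`-th
power of this map (`covForm_succ`). The powers are bounded uniformly up to the critical case `s = σ
^ 2`, at the price of a factor `k`, which gives a relative error of order `κ (1 + 2 k) ^ 2 exp (-k /
κ)` (`StepData.abs_covForm_sub_le`). Characteristic functions identify the law with the Gaussian
having these variances (`positionLaw_eq_multivariateGaussian`). Finally, a relative error `ε` in
each of `d` variances costs at most `8 d ε` in total variation (`tvDist_multivariateGaussian_le`),
so `ε = δ / (8 d)` suffices. -/

/-! ### One direction: stationary form, exact variance, powers of the step matrix. -/

/-- The momentum variance of the stationary law of the Euler–Maruyama scheme (`a = 0`) in the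
direction of an eigenvector with eigenvalue `s`. -/
noncomputable def stationaryMomentumVariance (γ h s : ℝ) : ℝ :=
  s * biasedVariance 0 γ h s / (1 - γ * h / 2 + h ^ 2 * s / 2)

/-- The variance of `u x + v p` under the stationary law of the scheme. -/
noncomputable def stationaryForm (γ h s u v : ℝ) : ℝ :=
  biasedVariance 0 γ h s * u ^ 2 - h * stationaryMomentumVariance γ h s * u * v +
    stationaryMomentumVariance γ h s * v ^ 2

/-- The coefficients `(a, b)` with `(α + h N) ^ k = a + b N`, where `α = 1 - h σ` and
`N ^ 2 = σ ^ 2 - s`. -/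
noncomputable def powCoeff (σ h s : ℝ) : ℕ → ℝ × ℝ
  | 0 => (1, 0)
  | k + 1 => ((1 - h * σ) * (powCoeff σ h s k).1 - h * (s - σ ^ 2) * (powCoeff σ h s k).2,
      (1 - h * σ) * (powCoeff σ h s k).2 + h * (powCoeff σ h s k).1)

/-- The variance of `u x + v p` after `k` steps of the scheme with friction `2 σ`, started from the
standard Gaussian law. -/
noncomputable def covForm (σ h s : ℝ) (k : ℕ) (u v : ℝ) : ℝ :=
  let a := (powCoeff σ h s k).1
  let b := (powCoeff σ h s k).2
  let u' := a * u + b * (σ * u - s * v)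
  let v' := a * v + b * (u - σ * v)
  stationaryForm (2 * σ) h s u v + (u' ^ 2 + v' ^ 2 - stationaryForm (2 * σ) h s u' v')

theorem covForm_zero (σ h s u v : ℝ) : covForm σ h s 0 u v = u ^ 2 + v ^ 2 := by
  simp [covForm, powCoeff]

/-- This is the Lyapunov equation of the scheme. The `u ^ 2` coefficient forces the cross term `-h W
u v`, where `W` is the momentum variance; the `u v` coefficient is `hW` in the proof and the `v ^ 2`
coefficient is `hW2`. -/
theorem stationaryForm_step {γ h s : ℝ} (hs : s ≠ 0) (h1 : h * s - γ ≠ 0)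
    (h2 : 4 + h * (h * s - 2 * γ) ≠ 0) (h3 : 1 - γ * h / 2 + h ^ 2 * s / 2 ≠ 0) (u v : ℝ) :
    stationaryForm γ h s (u - h * s * v) (h * u + (1 - γ * h) * v) + 2 * γ * h * v ^ 2 =
      stationaryForm γ h s u v := by
  have hW : stationaryMomentumVariance γ h s * (1 - γ * h / 2 + h ^ 2 * s / 2) =
      s * biasedVariance 0 γ h s := by
    rw [stationaryMomentumVariance, div_mul_cancel₀ _ h3]
  have hW2 : stationaryMomentumVariance γ h s = h ^ 2 * s ^ 2 * biasedVariance 0 γ h s +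
      h ^ 2 * s * (1 - γ * h) * stationaryMomentumVariance γ h s +
      (1 - γ * h) ^ 2 * stationaryMomentumVariance γ h s + 2 * γ * h := by
    have : biasedVariance 0 γ h s =
        (1 / s) * (1 - h * s * (4 + h * (h * s - γ)) /
          ((h * s - γ) * (4 + h * (h * s - 2 * γ)))) := by
      simp [biasedVariance]
    have hy : s * biasedVariance 0 γ h s * ((h * s - γ) * (4 + h * (h * s - 2 * γ))) =
        (h * s - γ) * (4 + h * (h * s - 2 * γ)) - h * s * (4 + h * (h * s - γ)) := by
      rw [this, ← mul_assoc s (1 / s), mul_one_div_cancel hs, one_mul, sub_mul, one_mul,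
        div_mul_cancel₀ _ (mul_ne_zero h1 h2)]
    have hWD : stationaryMomentumVariance γ h s *
        (h * (h * s - γ) * (4 + h * (h * s - 2 * γ))) = -4 * (γ * h) := by
      apply mul_left_cancel₀ h3
      linear_combination h * (h * s - γ) * (4 + h * (h * s - 2 * γ)) * hW + h * hy
    linear_combination h ^ 2 * s * hW - (1 / 2) * hWD
  unfold stationaryForm
  linear_combination 2 * h * u * v * hW - v ^ 2 * hW2

/-- The stationary form absorbs the noise term, and the defect is only transported: `a + b N`
commutes with the step `(1 - h σ) + h N`, which is the content of `e1` and `e2`. -/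
theorem covForm_succ {σ h s : ℝ} (hs : s ≠ 0) (h1 : h * s - 2 * σ ≠ 0)
    (h2 : 4 + h * (h * s - 2 * (2 * σ)) ≠ 0) (h3 : 1 - 2 * σ * h / 2 + h ^ 2 * s / 2 ≠ 0)
    (k : ℕ) (u v : ℝ) :
    covForm σ h s (k + 1) u v =
      covForm σ h s k (u - h * s * v) (h * u + (1 - 2 * σ * h) * v) +
        2 * (2 * σ) * h * v ^ 2 := by
  have key := stationaryForm_step hs h1 h2 h3 u v
  simp only [covForm, powCoeff]
  set a := (powCoeff σ h s k).1
  set b := (powCoeff σ h s k).2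
  have e1 : ((1 - h * σ) * a - h * (s - σ ^ 2) * b) * u +
      ((1 - h * σ) * b + h * a) * (σ * u - s * v) =
      a * (u - h * s * v) + b * (σ * (u - h * s * v) - s * (h * u + (1 - 2 * σ * h) * v)) := by
    ring
  have e2 : ((1 - h * σ) * a - h * (s - σ ^ 2) * b) * v +
      ((1 - h * σ) * b + h * a) * (u - σ * v) =
      a * (h * u + (1 - 2 * σ * h) * v) +
        b * ((u - h * s * v) - σ * (h * u + (1 - 2 * σ * h) * v)) := by
    ring
  rw [e1, e2]
  linarith

/-- The left side is the determinant of `a + b N`, which is multiplicative. -/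
theorem powCoeff_sq_add (σ h s : ℝ) (k : ℕ) :
    (powCoeff σ h s k).1 ^ 2 + (s - σ ^ 2) * (powCoeff σ h s k).2 ^ 2 =
      (1 - 2 * h * σ + h ^ 2 * s) ^ k := by
  induction k with
  | zero => simp [powCoeff]
  | succ k ih => simp only [powCoeff]; rw [pow_succ (1 - 2 * h * σ + h ^ 2 * s), ← ih]; ring

theorem abs_powCoeff_fst_le {σ h s q : ℝ} (hσs : σ ^ 2 ≤ s) (hq : 0 ≤ q)
    (hr0 : 0 ≤ 1 - 2 * h * σ + h ^ 2 * s) (hr : 1 - 2 * h * σ + h ^ 2 * s ≤ q ^ 2) (k : ℕ) :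
    |(powCoeff σ h s k).1| ≤ q ^ k := by
  refine abs_le_of_sq_le_sq ?_ (by positivity)
  calc _ ≤ (1 - 2 * h * σ + h ^ 2 * s) ^ k := by
        rw [← powCoeff_sq_add]
        have : 0 ≤ (s - σ ^ 2) * (powCoeff σ h s k).2 ^ 2 :=
          mul_nonneg (by linarith) (sq_nonneg _)
        linarith
    _ ≤ (q ^ 2) ^ k := pow_le_pow_left₀ hr0 hr k
    _ = _ := by rw [← pow_mul, ← pow_mul, mul_comm]

/-- The determinant identity loses control of `b` as `s` approaches `σ ^ 2`, where the step matrix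
becomes a Jordan block. The recursion instead adds at most `h q ^ k` at each step, hence the factor
`k`; `1 ≤ 2 q` raises the power to `q ^ (k + 1)`. -/
theorem abs_powCoeff_snd_le {σ h s q : ℝ} (hσs : σ ^ 2 ≤ s) (hh : 0 ≤ h) (hq : 1 ≤ 2 * q)
    (hr0 : 0 ≤ 1 - 2 * h * σ + h ^ 2 * s) (hr : 1 - 2 * h * σ + h ^ 2 * s ≤ q ^ 2)
    (hα0 : 0 ≤ 1 - h * σ) (hα : 1 - h * σ ≤ q) (k : ℕ) :
    |(powCoeff σ h s k).2| ≤ 2 * k * h * q ^ k := by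
  have hq0 : 0 ≤ q := by linarith
  induction k with
  | zero => simp [powCoeff]
  | succ k ih =>
    have ha := abs_powCoeff_fst_le hσs hq0 hr0 hr k
    simp only [powCoeff]
    calc _ ≤ |(1 - h * σ) * (powCoeff σ h s k).2| + |h * (powCoeff σ h s k).1| := abs_add_le _ _
      _ = (1 - h * σ) * |(powCoeff σ h s k).2| + h * |(powCoeff σ h s k).1| := by
        rw [abs_mul, abs_mul, abs_of_nonneg hα0, abs_of_nonneg hh]
      _ ≤ q * (2 * k * h * q ^ k) + h * q ^ k := by gcongr
      _ ≤ q * (2 * k * h * q ^ k) + h * (q ^ k * (2 * q)) := by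
        gcongr; exact le_mul_of_one_le_right (by positivity) hq
      _ = _ := by push_cast; ring

/-! ### Quantitative bounds in one direction. -/

/-- The standing assumptions on a direction with eigenvalue `s`, where `σ ^ 2` and `s₁` are the
least and the largest eigenvalue. -/
structure StepData (σ h s s₁ : ℝ) : Prop where
  σ_pos : 0 < σ
  σ_lt : σ < 1
  s₁_gt : 1 < s₁
  le_s : σ ^ 2 ≤ s
  s_le : s ≤ s₁
  h_eq : h = σ / s₁

namespace StepData

variable {σ h s s₁ : ℝ}

theorem hσ_mul (H : StepData σ h s s₁) : h * σ = σ ^ 2 / s₁ := by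
  rw [H.h_eq]; ring

theorem s_pos (H : StepData σ h s s₁) : 0 < s := by
  have := H.σ_pos
  exact lt_of_lt_of_le (by positivity) H.le_s

theorem h_pos (H : StepData σ h s s₁) : 0 < h := by
  rw [H.h_eq]; exact div_pos H.σ_pos (by linarith [H.s₁_gt])

theorem h_le_one (H : StepData σ h s s₁) : h ≤ 1 := by
  rw [H.h_eq, div_le_one (by linarith [H.s₁_gt])]; linarith [H.σ_lt, H.s₁_gt]

theorem hs_le (H : StepData σ h s s₁) : h * s ≤ σ := by
  have := H.s₁_gt
  rw [H.h_eq, div_mul_eq_mul_div, div_le_iff₀ (by linarith)]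
  exact mul_le_mul_of_nonneg_left H.s_le H.σ_pos.le

theorem hσ_pos (H : StepData σ h s s₁) : 0 < h * σ := mul_pos H.h_pos H.σ_pos

theorem hσ_lt_one (H : StepData σ h s s₁) : h * σ < 1 := by
  nlinarith [H.h_le_one, H.h_pos, H.σ_lt, H.σ_pos]

theorem hσ_sq_le (H : StepData σ h s s₁) : (h * σ) ^ 2 ≤ h ^ 2 * s := by
  rw [mul_pow]; exact mul_le_mul_of_nonneg_left H.le_s (sq_nonneg _)

theorem h_sq_mul_le (H : StepData σ h s s₁) : h ^ 2 * s ≤ h * σ := by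
  rw [pow_two, mul_assoc]; exact mul_le_mul_of_nonneg_left H.hs_le H.h_pos.le

/-- With `t = h σ < 1` and `h ^ 2 s ≥ t ^ 2`, the expression is at least `(2 - t) ^ 2`. -/
theorem one_le_den (H : StepData σ h s s₁) : 1 ≤ 4 + h * (h * s - 2 * (2 * σ)) := by
  nlinarith [H.hσ_sq_le, H.hσ_lt_one, H.hσ_pos]

theorem half_le_den (H : StepData σ h s s₁) : 1 / 2 ≤ 1 - 2 * σ * h / 2 + h ^ 2 * s / 2 := by
  nlinarith [H.hσ_sq_le, sq_nonneg (h * σ - 1)]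

theorem mul_biasedVariance (H : StepData σ h s s₁) :
    s * biasedVariance 0 (2 * σ) h s = 1 + h * s * (4 - h * (2 * σ - h * s)) /
      ((2 * σ - h * s) * (4 + h * (h * s - 2 * (2 * σ)))) := by
  have h1 : 2 * σ - h * s ≠ 0 := by linarith [H.hs_le, H.σ_pos]
  have h1' : h * s - 2 * σ ≠ 0 := by linarith [H.hs_le, H.σ_pos]
  have h2 : 4 + h * (h * s - 2 * (2 * σ)) ≠ 0 := by linarith [H.one_le_den]
  have h0 := H.s_pos.ne'
  have : biasedVariance 0 (2 * σ) h s =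
      (1 / s) * (1 - h * s * (4 + h * (h * s - 2 * σ)) /
        ((h * s - 2 * σ) * (4 + h * (h * s - 2 * (2 * σ))))) := by
    simp [biasedVariance]
  rw [this, ← mul_assoc, mul_one_div_cancel h0, one_mul, sub_eq_add_neg, ← div_neg]
  congr 2 <;> ring

theorem one_le_mul_biasedVariance (H : StepData σ h s s₁) :
    1 ≤ s * biasedVariance 0 (2 * σ) h s := by
  rw [H.mul_biasedVariance, le_add_iff_nonneg_right]
  have h1 : 0 ≤ 2 * σ - h * s := by linarith [H.hs_le, H.σ_pos]
  have h2 := H.one_le_den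
  have h3 : 0 ≤ 4 - h * (2 * σ - h * s) := by
    nlinarith [H.hσ_lt_one, mul_pos (pow_pos H.h_pos 2) H.s_pos]
  have := H.h_pos
  have := H.s_pos
  positivity

theorem mul_biasedVariance_le (H : StepData σ h s s₁) :
    s * biasedVariance 0 (2 * σ) h s ≤ 5 := by
  have h1 : σ ≤ 2 * σ - h * s := by linarith [H.hs_le, H.σ_pos]
  have h2 := H.one_le_den
  have h3 : 4 - h * (2 * σ - h * s) ≤ 4 := by nlinarith [H.h_pos, H.σ_pos]
  have := H.h_pos
  have := H.s_pos
  have := H.σ_pos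
  have hb : h * s * (4 - h * (2 * σ - h * s)) /
      ((2 * σ - h * s) * (4 + h * (h * s - 2 * (2 * σ)))) ≤ 4 := by
    have h1' : 0 < 2 * σ - h * s := by linarith
    rw [div_le_iff₀ (by positivity)]
    calc _ ≤ h * s * 4 := by gcongr
      _ ≤ σ * 4 := by gcongr; exact H.hs_le
      _ = 4 * (σ * 1) := by ring
      _ ≤ _ := by gcongr
  rw [H.mul_biasedVariance]
  linarith

theorem biasedVariance_pos (H : StepData σ h s s₁) : 0 < biasedVariance 0 (2 * σ) h s :=
  pos_of_mul_pos_right (lt_of_lt_of_le one_pos H.one_le_mul_biasedVariance) H.s_pos.le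

theorem momentumVariance_nonneg (H : StepData σ h s s₁) :
    0 ≤ stationaryMomentumVariance (2 * σ) h s :=
  div_nonneg (by linarith [H.one_le_mul_biasedVariance]) (by linarith [H.half_le_den])

theorem momentumVariance_le (H : StepData σ h s s₁) :
    stationaryMomentumVariance (2 * σ) h s ≤ 10 := by
  rw [stationaryMomentumVariance, div_le_iff₀ (by linarith [H.half_le_den])]
  linarith [H.half_le_den, H.mul_biasedVariance_le]

/-- The factor `1 / σ ^ 2` comes from the position variance, at most `5 / s ≤ 5 / σ ^ 2`; the cross
and momentum terms stay bounded. The constant is `6 + 10 + 11`. -/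
theorem abs_defect_le (H : StepData σ h s s₁) {m u v : ℝ} (hu : |u| ≤ m) (hv : |v| ≤ m) :
    |u ^ 2 + v ^ 2 - stationaryForm (2 * σ) h s u v| ≤ 27 / σ ^ 2 * m ^ 2 := by
  have hm : 0 ≤ m := (abs_nonneg u).trans hu
  have hσ2 : 0 < σ ^ 2 := pow_pos H.σ_pos 2
  have hσ1 : 1 ≤ 1 / σ ^ 2 := by
    rw [le_div_iff₀ hσ2]; nlinarith [H.σ_lt, H.σ_pos]
  have hy0 := H.biasedVariance_pos
  have hy : biasedVariance 0 (2 * σ) h s ≤ 5 * (1 / σ ^ 2) := by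
    rw [mul_one_div, le_div_iff₀ hσ2]
    nlinarith [H.mul_biasedVariance_le, H.le_s]
  have hW0 := H.momentumVariance_nonneg
  have hW := H.momentumVariance_le
  set y := biasedVariance 0 (2 * σ) h s
  set W := stationaryMomentumVariance (2 * σ) h s
  have hhW : h * W ≤ 10 := by nlinarith [H.h_le_one, H.h_pos]
  have hhW0 : 0 ≤ h * W := mul_nonneg H.h_pos.le hW0
  have e : u ^ 2 + v ^ 2 - stationaryForm (2 * σ) h s u v =
      (1 - y) * u ^ 2 + h * W * (u * v) + (1 - W) * v ^ 2 := by
    simp only [stationaryForm]; ring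
  have hu2 : u ^ 2 ≤ m ^ 2 := sq_le_sq' (by linarith [abs_le.1 hu]) (abs_le.1 hu).2
  have hv2 : v ^ 2 ≤ m ^ 2 := sq_le_sq' (by linarith [abs_le.1 hv]) (abs_le.1 hv).2
  have huv : |u * v| ≤ m ^ 2 := by
    rw [abs_mul, pow_two]; exact mul_le_mul hu hv (abs_nonneg _) hm
  have hyabs : |1 - y| ≤ 6 * (1 / σ ^ 2) := abs_le.2 ⟨by linarith, by linarith⟩
  have hWabs : |1 - W| ≤ 11 := abs_le.2 ⟨by linarith, by linarith⟩
  rw [e]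
  calc _ ≤ |(1 - y) * u ^ 2| + |h * W * (u * v)| + |(1 - W) * v ^ 2| := abs_add_three _ _ _
    _ = |1 - y| * u ^ 2 + h * W * |u * v| + |1 - W| * v ^ 2 := by
      rw [abs_mul, abs_mul (h * W), abs_mul (1 - W), abs_of_nonneg (sq_nonneg u),
        abs_of_nonneg (sq_nonneg v), abs_of_nonneg hhW0]
    _ ≤ 6 * (1 / σ ^ 2) * m ^ 2 + 10 * m ^ 2 + 11 * m ^ 2 := by gcongr
    _ ≤ 6 * (1 / σ ^ 2) * m ^ 2 + 21 * (1 / σ ^ 2) * m ^ 2 := by nlinarith [sq_nonneg m]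
    _ = _ := by ring

/-- The position variance converges geometrically to its stationary value. -/
theorem abs_covForm_sub_le (H : StepData σ h s s₁) (k : ℕ) :
    |covForm σ h s k 1 0 - biasedVariance 0 (2 * σ) h s| ≤
      27 * (s₁ / σ ^ 2) * (1 + 2 * k) ^ 2 * Real.exp (-(k / (s₁ / σ ^ 2))) *
        biasedVariance 0 (2 * σ) h s := by
  have hs1 : 0 < s₁ := by linarith [H.s₁_gt]
  have hσ := H.σ_pos
  -- Half the rate, because variances are quadratic in the powers: `q ^ 2 = exp (-h σ)` dominates
  -- the squared modulus of the eigenvalues.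
  set q := Real.exp (-(h * σ / 2)) with hq
  have hq1 : 1 - h * σ / 2 ≤ q := by
    have := Real.add_one_le_exp (-(h * σ / 2)); linarith
  have hq2 : q ^ 2 = Real.exp (-(h * σ)) := by
    rw [hq, ← Real.exp_nat_mul]; congr 1; push_cast; ring
  have hq0 : 0 < q := Real.exp_pos _
  have hr0 : 0 ≤ 1 - 2 * h * σ + h ^ 2 * s := by
    nlinarith [H.hσ_sq_le, sq_nonneg (1 - h * σ)]
  have hr : 1 - 2 * h * σ + h ^ 2 * s ≤ q ^ 2 := by
    rw [hq2]
    have := Real.add_one_le_exp (-(h * σ))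
    linarith [H.h_sq_mul_le]
  have ha := abs_powCoeff_fst_le H.le_s hq0.le hr0 hr k
  have hb := abs_powCoeff_snd_le H.le_s H.h_pos.le (by linarith [H.hσ_lt_one]) hr0 hr
    (by linarith [H.hσ_lt_one]) (by linarith [H.hσ_pos]) k
  have hqk : 0 < q ^ k := pow_pos hq0 k
  have hb' : |(powCoeff σ h s k).2| ≤ 2 * k * q ^ k := by
    refine hb.trans ?_
    exact mul_le_mul_of_nonneg_right (mul_le_of_le_one_right (by positivity) H.h_le_one) hqk.le
  have hv : |(powCoeff σ h s k).2| ≤ (1 + 2 * k) * q ^ k := by linarith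
  have hu : |(powCoeff σ h s k).1 + (powCoeff σ h s k).2 * σ| ≤ (1 + 2 * k) * q ^ k := by
    calc _ ≤ |(powCoeff σ h s k).1| + |(powCoeff σ h s k).2 * σ| := abs_add_le _ _
      _ ≤ q ^ k + 2 * k * q ^ k := by
        rw [abs_mul, abs_of_pos hσ]
        exact add_le_add ha ((mul_le_of_le_one_right (abs_nonneg _) H.σ_lt.le).trans hb')
      _ = _ := by ring
  have e : covForm σ h s k 1 0 - biasedVariance 0 (2 * σ) h s =
      ((powCoeff σ h s k).1 + (powCoeff σ h s k).2 * σ) ^ 2 + (powCoeff σ h s k).2 ^ 2 -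
        stationaryForm (2 * σ) h s ((powCoeff σ h s k).1 + (powCoeff σ h s k).2 * σ)
          (powCoeff σ h s k).2 := by
    simp only [covForm, mul_one, mul_zero, sub_zero, zero_add]
    simp only [stationaryForm]; ring
  have hexp : (q ^ k) ^ 2 = Real.exp (-(k / (s₁ / σ ^ 2))) := by
    rw [← pow_mul, mul_comm, pow_mul, hq2, ← Real.exp_nat_mul, H.hσ_mul]
    congr 1; field_simp
  -- Turns the absolute error into a relative one; the factor `s₁` joins `1 / σ ^ 2` to form `κ`.
  have hy : 1 ≤ s₁ * biasedVariance 0 (2 * σ) h s :=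
    H.one_le_mul_biasedVariance.trans
      (mul_le_mul_of_nonneg_right H.s_le H.biasedVariance_pos.le)
  rw [e]
  refine (H.abs_defect_le hu hv).trans ?_
  rw [mul_pow, hexp]
  set E := Real.exp (-(k / (s₁ / σ ^ 2)))
  have hE : 0 < E := Real.exp_pos _
  calc 27 / σ ^ 2 * ((1 + 2 * (k : ℝ)) ^ 2 * E)
      = 27 / σ ^ 2 * ((1 + 2 * (k : ℝ)) ^ 2 * E) * 1 := (mul_one _).symm
    _ ≤ 27 / σ ^ 2 * ((1 + 2 * (k : ℝ)) ^ 2 * E) * (s₁ * biasedVariance 0 (2 * σ) h s) := by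
      gcongr
    _ = _ := by ring

end StepData

/-! ### The number of steps. -/

/-- After `32 κ (log κ + log (1 / δ) + log d)` steps the relative error of the variances is at most
`δ / (8 d)`. -/
theorem relative_error_le {κ δ d k : ℝ} (hκ : 1 ≤ κ) (hδ : 0 < δ) (hδ1 : δ ≤ 1) (hd : 2 ≤ d)
    (hk : 32 * κ * (Real.log κ + Real.log (1 / δ) + Real.log d) ≤ k) :
    27 * κ * (1 + 2 * k) ^ 2 * Real.exp (-(k / κ)) ≤ δ / (8 * d) := by
  have hκ0 : 0 < κ := by linarith
  have hlog : 0 ≤ Real.log κ + Real.log (1 / δ) + Real.log d :=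
    add_nonneg (add_nonneg (Real.log_nonneg hκ)
      (Real.log_nonneg (by rw [le_div_iff₀ hδ]; linarith))) (Real.log_nonneg (by linarith))
  have hk0 : 0 ≤ k := le_trans (by positivity) hk
  set t := k / κ with ht
  have ht0 : 0 ≤ t := by positivity
  have hkt : k = t * κ := by rw [ht]; field_simp
  have hT : 32 * (Real.log κ + Real.log (1 / δ) + Real.log d) ≤ t := by
    rw [ht, le_div_iff₀ hκ0]; linarith
  -- Half of the decay `exp (-t)` pays for `(1 + 2 k) ^ 2`, the other half for the powers of `κ`,
  -- `d` and `1 / δ`.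
  have h1 : 1 + 2 * k ≤ κ * (8 * Real.exp (t / 4)) := by
    have := Real.add_one_le_exp (t / 4)
    calc 1 + 2 * k ≤ κ * (1 + 2 * t) := by rw [hkt]; nlinarith
      _ ≤ _ := by gcongr; linarith
  have h2 : κ ^ 16 * (1 / δ) ^ 16 * d ^ 16 ≤ Real.exp (t / 2) := by
    have : κ ^ 16 * (1 / δ) ^ 16 * d ^ 16 =
        Real.exp (16 * (Real.log κ + Real.log (1 / δ) + Real.log d)) := by
      rw [← Real.log_mul hκ0.ne' (by positivity), ← Real.log_mul (by positivity) (by linarith),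
        show (16 : ℝ) = ((16 : ℕ) : ℝ) by norm_num, Real.exp_nat_mul,
        Real.exp_log (by positivity), mul_pow, mul_pow]
    rw [this]
    exact Real.exp_le_exp.2 (by linarith)
  have hδ' : 1 ≤ 1 / δ := by rw [le_div_iff₀ hδ]; linarith
  -- Since `d ≥ 2`, fifteen of the sixteen factors `d` absorb the numerical constant; `27 * 64 * 8 ≤
  -- 2 ^ 15` is what the end needs.
  have h3 : 2 ^ 15 * κ ^ 3 * (1 / δ) * d ≤ Real.exp (t / 2) := by
    refine le_trans ?_ h2
    have a1 : κ ^ 3 ≤ κ ^ 16 := pow_le_pow_right₀ hκ (by norm_num)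
    have a2 : 1 / δ ≤ (1 / δ) ^ 16 := le_self_pow₀ hδ' (by norm_num)
    have a3 : (2 : ℝ) ^ 15 ≤ d ^ 15 := pow_le_pow_left₀ (by norm_num) hd 15
    calc _ = κ ^ 3 * (1 / δ) * (2 ^ 15 * d) := by ring
      _ ≤ κ ^ 16 * (1 / δ) ^ 16 * (d ^ 15 * d) := by gcongr
      _ = _ := by ring
  have hneg : Real.exp (-t) = Real.exp (-(t / 2)) * Real.exp (-(t / 2)) := by
    rw [← Real.exp_add]; congr 1; ring
  have hquart : Real.exp (t / 4) ^ 2 * Real.exp (-(t / 2)) = 1 := by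
    rw [← Real.exp_nat_mul, ← Real.exp_add, Real.exp_eq_one_iff]; push_cast; ring
  calc 27 * κ * (1 + 2 * k) ^ 2 * Real.exp (-t)
      ≤ 27 * κ * (κ * (8 * Real.exp (t / 4))) ^ 2 * Real.exp (-t) := by gcongr
    _ = 1728 * κ ^ 3 * Real.exp (-(t / 2)) * (Real.exp (t / 4) ^ 2 * Real.exp (-(t / 2))) := by
      rw [hneg]; ring
    _ = 1728 * κ ^ 3 / Real.exp (t / 2) := by rw [hquart, Real.exp_neg]; field_simp
    _ ≤ 1728 * κ ^ 3 / (2 ^ 15 * κ ^ 3 * (1 / δ) * d) := by gcongr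
    _ ≤ δ / (8 * d) := by
      rw [div_le_div_iff₀ (by positivity) (by positivity)]
      have : δ * (2 ^ 15 * κ ^ 3 * (1 / δ) * d) = 2 ^ 15 * κ ^ 3 * d := by field_simp
      rw [this]
      nlinarith [mul_pos (pow_pos hκ0 3) (show 0 < d by linarith)]

/-! ### Comparison of Gaussian laws in total variation. -/

theorem inner_toEuclideanCLM_left {ι : Type*} [Fintype ι] [DecidableEq ι] (M : Matrix ι ι ℝ)
    (x y : EuclideanSpace ℝ ι) :
    inner ℝ (toEuclideanCLM (𝕜 := ℝ) M x) y = inner ℝ x (toEuclideanCLM (𝕜 := ℝ) Mᵀ y) := by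
  rw [real_inner_comm, inner_toEuclideanCLM, inner_toEuclideanCLM, dotProduct_mulVec,
    ← mulVec_transpose, dotProduct_comm]
open scoped NNReal ENNReal

/-- The exponential factor increases with the variance, and the normalising constants differ by the
factor `√(c / a) ≤ r`. -/
theorem gaussianReal_le_smul {a c r : ℝ≥0} (ha : a ≠ 0) (hac : a ≤ c) (hcr : c ≤ r ^ 2 * a) :
    gaussianReal 0 a ≤ r • gaussianReal 0 c := by
  have ha' : 0 < a := pos_iff_ne_zero.2 ha
  have hc' : 0 < c := ha'.trans_le hac
  rw [gaussianReal_of_var_ne_zero _ ha, gaussianReal_of_var_ne_zero _ hc'.ne',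
    show r • volume.withDensity (gaussianPDF 0 c) =
      (r : ℝ≥0∞) • volume.withDensity (gaussianPDF 0 c) from rfl,
    ← withDensity_smul _ (measurable_gaussianPDF _ _)]
  refine withDensity_mono (ae_of_all _ fun x => ?_)
  have ha0 : (0 : ℝ) < a := ha'
  have hc0 : (0 : ℝ) < c := hc'
  simp only [Pi.smul_apply, smul_eq_mul, gaussianPDF, gaussianPDFReal_def]
  rw [← ENNReal.ofReal_coe_nnreal, ← ENNReal.ofReal_mul r.coe_nonneg, ← mul_assoc]
  refine ENNReal.ofReal_le_ofReal (mul_le_mul ?_ ?_ (Real.exp_pos _).le (by positivity))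
  · have h1 : √(2 * Real.pi * c) ≤ r * √(2 * Real.pi * a) := by
      rw [← Real.sqrt_sq r.coe_nonneg, ← Real.sqrt_mul (sq_nonneg _)]
      apply Real.sqrt_le_sqrt
      have : (c : ℝ) ≤ r ^ 2 * a := by exact_mod_cast hcr
      nlinarith [Real.pi_pos]
    have h2 : 0 < √(2 * Real.pi * a) := Real.sqrt_pos.2 (by positivity)
    have h3 : 0 < √(2 * Real.pi * c) := Real.sqrt_pos.2 (by positivity)
    rw [← div_eq_mul_inv, inv_eq_one_div, div_le_div_iff₀ h2 h3]
    linarith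
  · apply Real.exp_le_exp.2
    have : (a : ℝ) ≤ c := by exact_mod_cast hac
    rw [neg_div, neg_div, neg_le_neg_iff]
    gcongr

theorem MeasureTheory.Measure.pi_le_pi {ι : Type*} [Fintype ι] {α : ι → Type*}
    [∀ i, MeasurableSpace (α i)] {μ ν : ∀ i, Measure (α i)} (h : ∀ i, μ i ≤ ν i) :
    Measure.pi μ ≤ Measure.pi ν := by
  refine Measure.le_iff.2 fun A hA => ?_
  rw [Measure.pi, Measure.pi, toMeasure_apply _ _ hA, toMeasure_apply _ _ hA]
  have : OuterMeasure.pi (fun i => (μ i).toOuterMeasure) ≤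
      OuterMeasure.pi (fun i => (ν i).toOuterMeasure) := by
    rw [OuterMeasure.le_pi]
    intro s _
    exact (OuterMeasure.pi_pi_le _ s).trans (Finset.prod_le_prod' fun i _ => h i (s i))
  exact this A

theorem MeasureTheory.Measure.pi_smul_const {ι : Type*} [Fintype ι] {α : ι → Type*}
    [∀ i, MeasurableSpace (α i)] (ν : ∀ i, Measure (α i)) [∀ i, IsFiniteMeasure (ν i)] (r : ℝ≥0) :
    Measure.pi (fun i => r • ν i) = r ^ Fintype.card ι • Measure.pi ν := by
  refine Measure.pi_eq (μ := fun i => r • ν i) fun s _ => ?_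
  simp_rw [Measure.smul_apply, Measure.pi_pi, ENNReal.smul_def, smul_eq_mul,
    Finset.prod_mul_distrib, Finset.prod_const, ENNReal.coe_pow, Finset.card_univ]

/-- Domination bounds `μ A` from above; applied to the complement it bounds `μ A` from below. -/
theorem abs_real_sub_le_of_le_smul {α : Type*} [MeasurableSpace α] {μ ν : Measure α}
    [IsProbabilityMeasure μ] [IsProbabilityMeasure ν] {K : ℝ≥0} (h : μ ≤ K • ν) {A : Set α}
    (hA : MeasurableSet A) : |μ.real A - ν.real A| ≤ K - 1 := by
  have key (B : Set α) : μ.real B ≤ K * ν.real B := by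
    have h1 := h B
    rw [Measure.smul_apply, ENNReal.smul_def, smul_eq_mul] at h1
    have h2 := ENNReal.toReal_mono (ENNReal.mul_ne_top ENNReal.coe_ne_top (measure_ne_top ν B)) h1
    simpa [Measure.real, ENNReal.toReal_mul] using h2
  have hK : (1 : ℝ) ≤ K := by simpa using key Set.univ
  have h1 := key A
  have h2 := key Aᶜ
  rw [probReal_compl_eq_one_sub hA, probReal_compl_eq_one_sub hA] at h2
  have h3 : ν.real A ≤ 1 := measureReal_le_one
  have h4 : 0 ≤ ν.real A := measureReal_nonneg
  rw [abs_le]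
  constructor <;> nlinarith

theorem tvDist_nonneg {α : Type*} [MeasurableSpace α] (μ ν : Measure α) : 0 ≤ tvDist μ ν :=
  Real.iSup_nonneg fun _ => abs_nonneg _

theorem tvDist_le_of_le_smul {α : Type*} [MeasurableSpace α] {μ ν τ : Measure α}
    [IsProbabilityMeasure μ] [IsProbabilityMeasure ν] [IsProbabilityMeasure τ] {K : ℝ≥0}
    (hμ : μ ≤ K • τ) (hν : ν ≤ K • τ) : tvDist μ ν ≤ 2 * (K - 1) := by
  have : Nonempty {A : Set α // MeasurableSet A} := ⟨⟨∅, MeasurableSet.empty⟩⟩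
  refine ciSup_le fun A => ?_
  have h1 := abs_real_sub_le_of_le_smul hμ A.2
  have h2 := abs_real_sub_le_of_le_smul hν A.2
  rw [abs_sub_comm] at h2
  calc _ ≤ |μ.real A.1 - τ.real A.1| + |τ.real A.1 - ν.real A.1| := abs_sub_le _ _ _
    _ ≤ _ := by linarith

theorem posSemidef_conj_diagonal {ι : Type*} [Fintype ι] [DecidableEq ι] (P : Matrix ι ι ℝ)
    {A : ι → ℝ} (hA : ∀ i, 0 ≤ A i) : (P * diagonal A * Pᵀ).PosSemidef := by
  have := (PosSemidef.diagonal (n := ι) (d := A) hA).mul_mul_conjTranspose_same P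
  simpa using this

theorem dotProduct_conj_diagonal {ι : Type*} [Fintype ι] [DecidableEq ι] (P : Matrix ι ι ℝ)
    (A : ι → ℝ) (x : ι → ℝ) :
    x ⬝ᵥ ((P * diagonal A * Pᵀ) *ᵥ x) = ∑ i, A i * ((Pᵀ *ᵥ x) i) ^ 2 := by
  rw [← mulVec_mulVec, ← mulVec_mulVec, dotProduct_mulVec, ← mulVec_transpose, dotProduct]
  refine Finset.sum_congr rfl fun i _ => ?_
  rw [mulVec_diagonal]; ring

/-- A centred Gaussian law with covariance matrix `P * diagonal A * Pᵀ` is the image under `P` of a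
product of centred real Gaussian laws. -/
theorem multivariateGaussian_conj_diagonal {ι : Type*} [Fintype ι] [DecidableEq ι]
    (P : Matrix ι ι ℝ) {A : ι → ℝ} (hA : ∀ i, 0 ≤ A i) :
    multivariateGaussian 0 (P * diagonal A * Pᵀ) =
      (Measure.pi fun i => gaussianReal 0 (A i).toNNReal).map
        (fun x => toEuclideanCLM (𝕜 := ℝ) P (WithLp.toLp 2 x)) := by
  have hmap : (Measure.pi fun i => gaussianReal 0 (A i).toNNReal).map
        (fun x => toEuclideanCLM (𝕜 := ℝ) P (WithLp.toLp 2 x)) =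
      ((Measure.pi fun i => gaussianReal 0 (A i).toNNReal).map (WithLp.toLp 2)).map
        (toEuclideanCLM (𝕜 := ℝ) P) := by
    rw [Measure.map_map (by fun_prop) (by fun_prop)]; rfl
  have : IsProbabilityMeasure ((Measure.pi fun i => gaussianReal 0 (A i).toNNReal).map
      (WithLp.toLp 2)) := Measure.isProbabilityMeasure_map (by fun_prop)
  have : IsProbabilityMeasure (((Measure.pi fun i => gaussianReal 0 (A i).toNNReal).map
      (WithLp.toLp 2)).map (toEuclideanCLM (𝕜 := ℝ) P)) :=
    Measure.isProbabilityMeasure_map (by fun_prop)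
  rw [hmap]
  apply Measure.ext_of_charFun
  ext t
  rw [charFun_multivariateGaussian (posSemidef_conj_diagonal P hA), dotProduct_conj_diagonal,
    charFun_apply,
    integral_map (by fun_prop) (by fun_prop)]
  simp_rw [inner_toEuclideanCLM_left]
  rw [← charFun_apply, charFun_pi]
  simp_rw [charFun_gaussianReal, ← Complex.exp_sum]
  congr 1
  simp only [inner_zero_right, Complex.ofReal_zero, zero_mul, mul_zero, zero_sub,
    Finset.sum_neg_distrib, ← Finset.sum_div, ofLp_toEuclideanCLM, Real.coe_toNNReal _ (hA _)]
  push_cast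
  rfl

theorem multivariateGaussian_conj_diagonal_le_smul {ι : Type*} [Fintype ι] [DecidableEq ι]
    (P : Matrix ι ι ℝ) {A c : ι → ℝ} {r : ℝ≥0} (hA : ∀ i, 0 < A i) (hAc : ∀ i, A i ≤ c i)
    (hc : ∀ i, c i ≤ r ^ 2 * A i) :
    multivariateGaussian 0 (P * diagonal A * Pᵀ) ≤
      r ^ Fintype.card ι • multivariateGaussian 0 (P * diagonal c * Pᵀ) := by
  rw [multivariateGaussian_conj_diagonal P fun i => (hA i).le,
    multivariateGaussian_conj_diagonal P fun i => (hA i).le.trans (hAc i), ← Measure.map_smul,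
    ← Measure.pi_smul_const]
  refine Measure.map_mono (Measure.pi_le_pi fun i => ?_) (by fun_prop)
  refine gaussianReal_le_smul ?_ (Real.toNNReal_le_toNNReal (hAc i)) ?_
  · simpa using hA i
  · rw [Real.toNNReal_le_iff_le_coe]
    push_cast
    rw [Real.coe_toNNReal _ (hA i).le]
    exact hc i

/-- Neither law need have the larger variance in all coordinates. Both are therefore compared with
the Gaussian whose variances are the coordinatewise maxima, which dominates each up to the factor `r
^ d`. -/
theorem tvDist_multivariateGaussian_le {d : ℕ} (hd : 0 < d) (P : Matrix (Fin d) (Fin d) ℝ)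
    {A y : Fin d → ℝ} {ε : ℝ} (hε : 0 ≤ ε) (hdε : 8 * d * ε ≤ 1) (hy : ∀ i, 0 < y i)
    (hA : ∀ i, |A i - y i| ≤ ε * y i) :
    tvDist (multivariateGaussian 0 (P * diagonal A * Pᵀ))
      (multivariateGaussian 0 (P * diagonal y * Pᵀ)) ≤ 8 * d * ε := by
  have hd1 : (1 : ℝ) ≤ d := by exact_mod_cast hd
  have hε8 : ε ≤ 1 / 8 := by nlinarith
  have hA' (i : Fin d) : (1 - ε) * y i ≤ A i := by linarith [(abs_le.1 (hA i)).1]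
  have hA'' (i : Fin d) : A i ≤ (1 + ε) * y i := by linarith [(abs_le.1 (hA i)).2]
  have hA0 (i : Fin d) : 0 < A i := lt_of_lt_of_le (mul_pos (by linarith) (hy i)) (hA' i)
  -- For `ε ≤ 1 / 8` this gives `r ^ 2 * (1 - ε) ≥ 1` and `r ^ 2 ≥ 1 + ε`, so each variance is at
  -- most `r ^ 2` times the other.
  let r : ℝ≥0 := ⟨1 + 2 * ε, by linarith⟩
  have hr : (r : ℝ) = 1 + 2 * ε := rfl
  have hr1 : 1 ≤ (r : ℝ) ^ 2 := by rw [hr]; nlinarith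
  have hr2 : 1 + ε ≤ (r : ℝ) ^ 2 := by rw [hr]; nlinarith
  have hr3 : 1 ≤ (r : ℝ) ^ 2 * (1 - ε) := by
    rw [hr]; nlinarith [mul_nonneg hε (show 0 ≤ 3 - 4 * ε ^ 2 by nlinarith)]
  have hyA (i : Fin d) : y i ≤ (r : ℝ) ^ 2 * A i :=
    calc y i ≤ (r : ℝ) ^ 2 * (1 - ε) * y i := le_mul_of_one_le_left (hy i).le hr3
      _ = (r : ℝ) ^ 2 * ((1 - ε) * y i) := by ring
      _ ≤ _ := by gcongr; exact hA' i
  have hAy (i : Fin d) : A i ≤ (r : ℝ) ^ 2 * y i :=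
    (hA'' i).trans (mul_le_mul_of_nonneg_right hr2 (hy i).le)
  have h1 := multivariateGaussian_conj_diagonal_le_smul P (A := A)
    (c := fun i => max (A i) (y i)) (r := r) hA0 (fun i => le_max_left _ _)
    fun i => max_le (le_mul_of_one_le_left (hA0 i).le hr1) (hyA i)
  have h2 := multivariateGaussian_conj_diagonal_le_smul P (A := y)
    (c := fun i => max (A i) (y i)) (r := r) hy (fun i => le_max_right _ _)
    fun i => max_le (hAy i) (le_mul_of_one_le_left (hy i).le hr1)
  refine (tvDist_le_of_le_smul h1 h2).trans ?_
  -- As `2 d ε ≤ 1`, one gets `r ^ d ≤ exp (2 d ε) ≤ 1 + 4 d ε`.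
  have h3 : (1 + 2 * ε) ^ d ≤ Real.exp (2 * d * ε) := by
    have : Real.exp (2 * d * ε) = Real.exp (2 * ε) ^ d := by
      rw [← Real.exp_nat_mul]; congr 1; ring
    rw [this]
    exact pow_le_pow_left₀ (by linarith) (by linarith [Real.add_one_le_exp (2 * ε)]) d
  have h4 := (le_abs_self _).trans
    (Real.abs_exp_sub_one_le (x := 2 * d * ε) (by rw [abs_of_nonneg (by positivity)]; linarith))
  rw [abs_of_nonneg (by positivity)] at h4
  rw [NNReal.coe_pow, hr, Fintype.card_fin]
  linarith

/-! ### The law of the scheme through characteristic functions. -/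

theorem gradient_quadPotential {d : ℕ} {S : Matrix (Fin d) (Fin d) ℝ} (hS : (S⁻¹)ᵀ = S⁻¹)
    (x : EuclideanSpace ℝ (Fin d)) :
    gradient (quadPotential S) x = toEuclideanCLM (𝕜 := ℝ) S⁻¹ x := by
  set T := toEuclideanCLM (𝕜 := ℝ) S⁻¹ with hT
  have hf : quadPotential S = fun x => (1 / 2) * inner ℝ x (T x) := by
    ext x
    rw [quadPotential, EuclideanSpace.inner_eq_star_dotProduct, dotProduct_comm]
    simp [hT]
  have hsymm (u v : EuclideanSpace ℝ (Fin d)) : inner ℝ (T u) v = inner ℝ u (T v) := by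
    rw [hT, inner_toEuclideanCLM_left, hS]
  apply HasGradientAt.gradient
  rw [hasGradientAt_iff_hasFDerivAt, hf]
  have h := ((hasFDerivAt_id x).inner ℝ (T.hasFDerivAt (x := x))).const_mul (1 / 2 : ℝ)
  refine h.congr_fderiv ?_
  ext v
  have : inner ℝ v (T x) = inner ℝ (T x) v := real_inner_comm _ _
  simp [this, ← hsymm x v]
  ring

/-- The characteristic function of the law after `k` steps. -/
theorem integral_exp_eulerMaruyama {d : ℕ} {S P : Matrix (Fin d) (Fin d) ℝ} {s : Fin d → ℝ}
    {σ h : ℝ} (hP : P ∈ Matrix.orthogonalGroup (Fin d) ℝ) (hS : S⁻¹ = P * diagonal s * Pᵀ)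
    (hσ : 0 ≤ σ * h) (hs : ∀ i, s i ≠ 0) (h1 : ∀ i, h * s i - 2 * σ ≠ 0)
    (h2 : ∀ i, 4 + h * (h * s i - 2 * (2 * σ)) ≠ 0)
    (h3 : ∀ i, 1 - 2 * σ * h / 2 + h ^ 2 * s i / 2 ≠ 0) (k : ℕ) :
    IsProbabilityMeasure
      ((eulerMaruyamaOp (quadPotential S) 0 (2 * σ) h)^[k] (stdGaussianPair d)) ∧
    ∀ u v : EuclideanSpace ℝ (Fin d),
      ∫ X, Complex.exp ((inner ℝ X.1 u + inner ℝ X.2 v : ℝ) * Complex.I)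
        ∂((eulerMaruyamaOp (quadPotential S) 0 (2 * σ) h)^[k] (stdGaussianPair d)) =
      Complex.exp ((-(∑ i, covForm σ h (s i) k ((Pᵀ *ᵥ u.ofLp) i) ((Pᵀ *ᵥ v.ofLp) i)) / 2 : ℝ)) := by
  have hPP : P * Pᵀ = 1 := (mem_orthogonalGroup_iff (Fin d) ℝ).1 hP
  have hPP' : Pᵀ * P = 1 := (mem_orthogonalGroup_iff' (Fin d) ℝ).1 hP
  have hSt : (S⁻¹)ᵀ = S⁻¹ := by
    rw [hS]; simp [Matrix.transpose_mul, Matrix.mul_assoc]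
  have hnorm (v : EuclideanSpace ℝ (Fin d)) : ∑ i, ((Pᵀ *ᵥ v.ofLp) i) ^ 2 = ‖v‖ ^ 2 := by
    have : (Pᵀ *ᵥ v.ofLp) ⬝ᵥ (Pᵀ *ᵥ v.ofLp) = v.ofLp ⬝ᵥ v.ofLp := by
      rw [dotProduct_mulVec, ← mulVec_transpose, transpose_transpose, mulVec_mulVec, hPP,
        one_mulVec]
    rw [EuclideanSpace.real_norm_sq_eq]
    simpa [dotProduct, pow_two] using this
  set T := toEuclideanCLM (𝕜 := ℝ) S⁻¹ with hT
  have hgrad : gradient (quadPotential S) = fun x => T x := by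
    ext1 x; exact gradient_quadPotential hSt x
  have hmeas : Measurable fun Xz : (EuclideanSpace ℝ (Fin d) × EuclideanSpace ℝ (Fin d)) ×
      (EuclideanSpace ℝ (Fin d) × EuclideanSpace ℝ (Fin d)) =>
      eulerMaruyamaStep (quadPotential S) 0 (2 * σ) h Xz.1 Xz.2 := by
    simp only [eulerMaruyamaStep, hgrad]
    fun_prop
  have hstd : IsProbabilityMeasure (stdGaussianPair d) := by
    unfold stdGaussianPair; infer_instance
  induction k with
  | zero =>
    refine ⟨by simpa using hstd, fun u v => ?_⟩
    simp only [Function.iterate_zero, id, covForm_zero, Finset.sum_add_distrib, hnorm]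
    have := integral_prod_mul (μ := stdGaussian (EuclideanSpace ℝ (Fin d)))
      (ν := stdGaussian (EuclideanSpace ℝ (Fin d)))
      (fun x => Complex.exp ((inner ℝ x u : ℝ) * Complex.I))
      (fun x => Complex.exp ((inner ℝ x v : ℝ) * Complex.I))
    rw [← charFun_apply, ← charFun_apply, charFun_stdGaussian, charFun_stdGaussian,
      ← Complex.exp_add] at this
    rw [stdGaussianPair]
    convert this using 1
    · simp only [← Complex.exp_add, ← add_mul, Complex.ofReal_add]
    · congr 1; push_cast; ring
  | succ k ih =>
    obtain ⟨hprob, ih⟩ := ih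
    rw [Function.iterate_succ_apply']
    set μ := (eulerMaruyamaOp (quadPotential S) 0 (2 * σ) h)^[k] (stdGaussianPair d) with hμ
    refine ⟨Measure.isProbabilityMeasure_map hmeas.aemeasurable, fun u v => ?_⟩
    -- The transposed drift acting on the test pair: `(u, v)` tested after the step is `(u', v')`
    -- tested before it, plus independent noise.
    set u' := u - h • T v with hu'
    set v' := h • u + (1 - 2 * σ * h) • v with hv'
    have hstep (X z : EuclideanSpace ℝ (Fin d) × EuclideanSpace ℝ (Fin d)) :
        Complex.exp ((inner ℝ (eulerMaruyamaStep (quadPotential S) 0 (2 * σ) h X z).1 u +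
          inner ℝ (eulerMaruyamaStep (quadPotential S) 0 (2 * σ) h X z).2 v : ℝ) * Complex.I) =
        Complex.exp ((inner ℝ X.1 u' + inner ℝ X.2 v' : ℝ) * Complex.I) *
          Complex.exp ((inner ℝ z.2 (√(2 * (2 * σ) * h) • v) : ℝ) * Complex.I) := by
      rw [← Complex.exp_add, ← add_mul, ← Complex.ofReal_add]
      congr 3
      have hsymm : inner ℝ (T X.1) v = inner ℝ X.1 (T v) := by
        rw [hT, inner_toEuclideanCLM_left, hSt]
      simp only [eulerMaruyamaStep, hgrad, hu', hv', inner_add_left, inner_sub_left,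
        inner_add_right, inner_sub_right, real_inner_smul_left, real_inner_smul_right, hsymm]
      simp
      ring
    have hnoise : ∫ z, Complex.exp ((inner ℝ z.2 (√(2 * (2 * σ) * h) • v) : ℝ) * Complex.I)
        ∂(stdGaussianPair d) = Complex.exp ((-(2 * (2 * σ) * h * ‖v‖ ^ 2) / 2 : ℝ)) := by
      have := integral_fun_snd (μ := stdGaussian (EuclideanSpace ℝ (Fin d)))
        (ν := stdGaussian (EuclideanSpace ℝ (Fin d)))
        (fun x => Complex.exp ((inner ℝ x (√(2 * (2 * σ) * h) • v) : ℝ) * Complex.I))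
      rw [stdGaussianPair, this, ← charFun_apply, charFun_stdGaussian, ← Complex.ofReal_pow, norm_smul,
        mul_pow, Real.norm_of_nonneg (Real.sqrt_nonneg _), Real.sq_sqrt (by nlinarith),
        probReal_univ, one_smul]
      push_cast
      rfl
    rw [eulerMaruyamaOp, integral_map hmeas.aemeasurable (by fun_prop)]
    simp_rw [hstep]
    rw [integral_prod_mul (μ := μ) (ν := stdGaussianPair d)
      (fun X => Complex.exp ((inner ℝ X.1 u' + inner ℝ X.2 v' : ℝ) * Complex.I))
      (fun z => Complex.exp ((inner ℝ z.2 (√(2 * (2 * σ) * h) • v) : ℝ) * Complex.I)),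
      hnoise, ih, ← Complex.exp_add, ← Complex.ofReal_add]
    congr 2
    have hu'i (i : Fin d) : (Pᵀ *ᵥ u'.ofLp) i =
        (Pᵀ *ᵥ u.ofLp) i - h * s i * (Pᵀ *ᵥ v.ofLp) i := by
      have : Pᵀ *ᵥ (S⁻¹ *ᵥ v.ofLp) = diagonal s *ᵥ (Pᵀ *ᵥ v.ofLp) := by
        rw [hS, mulVec_mulVec, ← Matrix.mul_assoc, ← Matrix.mul_assoc, hPP', Matrix.one_mul,
          mulVec_mulVec]
      simp only [hu', hT, WithLp.ofLp_sub, WithLp.ofLp_smul, ofLp_toEuclideanCLM, mulVec_sub,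
        mulVec_smul, this, Pi.sub_apply, Pi.smul_apply, mulVec_diagonal, smul_eq_mul]
      ring
    have hv'i (i : Fin d) : (Pᵀ *ᵥ v'.ofLp) i =
        h * (Pᵀ *ᵥ u.ofLp) i + (1 - 2 * σ * h) * (Pᵀ *ᵥ v.ofLp) i := by
      simp only [hv', WithLp.ofLp_add, WithLp.ofLp_smul, mulVec_add, mulVec_smul, Pi.add_apply,
        Pi.smul_apply, smul_eq_mul]
    simp_rw [hu'i, hv'i, covForm_succ (hs _) (h1 _) (h2 _) (h3 _), Finset.sum_add_distrib,
      ← Finset.mul_sum, hnorm]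
    ring

theorem positionLaw_eq_multivariateGaussian {d : ℕ} {S P : Matrix (Fin d) (Fin d) ℝ}
    {s : Fin d → ℝ} {σ h : ℝ} (hP : P ∈ Matrix.orthogonalGroup (Fin d) ℝ)
    (hS : S⁻¹ = P * diagonal s * Pᵀ)
    (hσ : 0 ≤ σ * h) (hs : ∀ i, s i ≠ 0) (h1 : ∀ i, h * s i - 2 * σ ≠ 0)
    (h2 : ∀ i, 4 + h * (h * s i - 2 * (2 * σ)) ≠ 0)
    (h3 : ∀ i, 1 - 2 * σ * h / 2 + h ^ 2 * s i / 2 ≠ 0) (k : ℕ)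
    (hA : ∀ i, 0 ≤ covForm σ h (s i) k 1 0) :
    positionLaw (quadPotential S) 0 (2 * σ) h k =
      multivariateGaussian 0 (P * diagonal (fun i => covForm σ h (s i) k 1 0) * Pᵀ) := by
  obtain ⟨hprob, hchar⟩ := integral_exp_eulerMaruyama hP hS hσ hs h1 h2 h3 k
  have : IsProbabilityMeasure (positionLaw (quadPotential S) 0 (2 * σ) h k) :=
    Measure.isProbabilityMeasure_map (by fun_prop)
  apply Measure.ext_of_charFun
  ext t
  rw [charFun_multivariateGaussian (posSemidef_conj_diagonal P hA), dotProduct_conj_diagonal,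
    charFun_apply, positionLaw, Measure.fst, integral_map (by fun_prop) (by fun_prop)]
  have ht := hchar t 0
  simp only [inner_zero_right, add_zero] at ht
  rw [ht]
  congr 1
  have hhom (i : Fin d) (x : ℝ) : covForm σ h (s i) k x 0 = covForm σ h (s i) k 1 0 * x ^ 2 := by
    simp only [covForm, stationaryForm]; ring
  have hsum : ∑ i, covForm σ h (s i) k ((Pᵀ *ᵥ t.ofLp) i) ((Pᵀ *ᵥ (0 : Fin d → ℝ)) i) =
      ∑ i, covForm σ h (s i) k 1 0 * ((Pᵀ *ᵥ t.ofLp) i) ^ 2 := by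
    refine Finset.sum_congr rfl fun i _ => ?_
    rw [mulVec_zero, Pi.zero_apply, hhom]
  rw [WithLp.ofLp_zero, hsum]
  simp only [inner_zero_right, Complex.ofReal_zero, zero_mul, zero_sub]
  push_cast
  ring

/-! ### The mixing time. -/

theorem pos_of_inv_eq_conj_diagonal {ι : Type*} [Fintype ι] [DecidableEq ι] {S P : Matrix ι ι ℝ}
    {s : ι → ℝ} (hS : S.PosDef) (hP : P ∈ Matrix.orthogonalGroup ι ℝ)
    (hSP : S⁻¹ = P * diagonal s * Pᵀ) (i : ι) : 0 < s i := by
  have hPP' : Pᵀ * P = 1 := (mem_orthogonalGroup_iff' ι ℝ).1 hP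
  have hinv := hS.inv
  rw [hSP] at hinv
  have hx : P *ᵥ Pi.single i 1 ≠ 0 := by
    intro h0
    have : Pᵀ *ᵥ (P *ᵥ Pi.single i (1 : ℝ)) = 0 := by rw [h0, mulVec_zero]
    rw [mulVec_mulVec, hPP', one_mulVec] at this
    simpa using congrFun this i
  have h := hinv.dotProduct_mulVec_pos hx
  rw [star_trivial, dotProduct_conj_diagonal, mulVec_mulVec, hPP', one_mulVec] at h
  simpa [Pi.single_apply] using h

theorem mainTheorem6 :
    ∃ C : ℝ, 0 < C ∧
      ∀ (d : ℕ) (hd : 0 < d) (S P : Matrix (Fin d) (Fin d) ℝ) (s : Fin d → ℝ) (s₁ s_d κ γ h : ℝ),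
        S.PosDef →
        P ∈ Matrix.orthogonalGroup (Fin d) ℝ →
        S⁻¹ = P * Matrix.diagonal s * Pᵀ →
        Antitone s →
        s₁ = s ⟨0, hd⟩ →
        s_d = s ⟨d - 1, Nat.sub_lt hd Nat.one_pos⟩ →
        1 < s₁ → s_d < 1 →
        κ = s₁ / s_d →
        γ = 2 * √s_d →
        h = √s_d / s₁ →
        Tendsto (fun k => tvDist (positionLaw (quadPotential S) 0 γ h k) (biasedTarget P s 0 γ h))
            atTop (𝓝 0) ∧
          ∀ δ : ℝ, 0 < δ → δ < 1 →
            ∃ N : ℕ,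
              IsMixingTime (positionLaw (quadPotential S) 0 γ h) (biasedTarget P s 0 γ h) δ N ∧
              (N : ℝ) ≤ C * ((Real.log κ + Real.log (1 / δ) + Real.log d) / (1 / κ)) := by
  -- `32` from the error bound, and `2` to absorb the rounding up to an integer, since `1 ≤ 2 κ L`.
  refine ⟨34, by norm_num, ?_⟩
  intro d hd S P s s₁ s_d κ γ h hS hP hSP hs hs₁ hs_d h1 hd1 hκ hγ hh
  have hpos := pos_of_inv_eq_conj_diagonal hS hP hSP
  have hsd0 : 0 < s_d := hs_d ▸ hpos _
  obtain ⟨σ, hσ⟩ : ∃ σ, σ = √s_d := ⟨_, rfl⟩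
  have hσ2 : σ ^ 2 = s_d := by rw [hσ, Real.sq_sqrt hsd0.le]
  have hσ0 : 0 < σ := by rw [hσ]; exact Real.sqrt_pos.2 hsd0
  rw [← hσ] at hγ hh
  subst hγ
  -- The strict inequalities `s_d < 1 < s₁` exclude `d = 1`; hence `log d ≥ log 2`, which keeps the
  -- bound away from zero.
  have hd2 : (2 : ℝ) ≤ d := by
    have : 2 ≤ d := by
      by_contra hlt
      obtain rfl : d = 1 := by omega
      have : s_d = s₁ := by rw [hs_d, hs₁]
      linarith
    exact_mod_cast this
  have H (i : Fin d) : StepData σ h (s i) s₁ :=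
    { σ_pos := hσ0
      σ_lt := by nlinarith
      s₁_gt := h1
      le_s := by
        have hi : i ≤ ⟨d - 1, Nat.sub_lt hd Nat.one_pos⟩ := Nat.le_sub_one_of_lt i.2
        rw [hσ2, hs_d]
        exact hs hi
      s_le := by
        have hi : (⟨0, hd⟩ : Fin d) ≤ i := Nat.zero_le _
        rw [hs₁]
        exact hs hi
      h_eq := hh }
  have hκ1 : 1 ≤ κ := by rw [hκ, le_div_iff₀ hsd0]; linarith
  have hmix (δ : ℝ) (hδ : 0 < δ) (hδ1 : δ < 1) (k : ℕ)
      (hk : 32 * κ * (Real.log κ + Real.log (1 / δ) + Real.log d) ≤ k) :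
      tvDist (positionLaw (quadPotential S) 0 (2 * σ) h k) (biasedTarget P s 0 (2 * σ) h) ≤ δ := by
    have herr := relative_error_le hκ1 hδ hδ1.le hd2 hk
    set ε := δ / (8 * d) with hε
    have hε0 : 0 < ε := by positivity
    have hdε : 8 * d * ε = δ := by rw [hε]; field_simp
    have hA (i : Fin d) : |covForm σ h (s i) k 1 0 - biasedVariance 0 (2 * σ) h (s i)| ≤
        ε * biasedVariance 0 (2 * σ) h (s i) := by
      refine ((H i).abs_covForm_sub_le k).trans ?_
      rw [hσ2, ← hκ]
      exact mul_le_mul_of_nonneg_right herr (H i).biasedVariance_pos.le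
    have hε1 : ε ≤ 1 := by nlinarith
    have hA0 (i : Fin d) : 0 ≤ covForm σ h (s i) k 1 0 := by
      nlinarith [(abs_le.1 (hA i)).1, (H i).biasedVariance_pos]
    rw [positionLaw_eq_multivariateGaussian hP hSP (mul_pos hσ0 (H ⟨0, hd⟩).h_pos).le
      (fun i => (hpos i).ne') (fun i => by linarith [(H i).hs_le])
      (fun i => by linarith [(H i).one_le_den]) (fun i => by linarith [(H i).half_le_den]) k hA0,
      biasedTarget, ← hdε]
    exact tvDist_multivariateGaussian_le hd P hε0.le (by linarith)
      (fun i => (H i).biasedVariance_pos) hA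
  constructor
  · rw [Metric.tendsto_atTop]
    intro η hη
    -- `hmix` needs a tolerance below `1`; halving `η` makes the final inequality strict.
    have hδ : 0 < min (η / 2) (1 / 2) := by positivity
    obtain ⟨N, hN⟩ := exists_nat_ge
      (32 * κ * (Real.log κ + Real.log (1 / min (η / 2) (1 / 2)) + Real.log d))
    refine ⟨N, fun k hk => ?_⟩
    have := hmix _ hδ (lt_of_le_of_lt (min_le_right _ _) (by norm_num)) k
      (hN.trans (by exact_mod_cast hk))
    rw [Real.dist_0_eq_abs, abs_of_nonneg (tvDist_nonneg _ _)]
    linarith [min_le_left (η / 2) (1 / 2 : ℝ)]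
  · intro δ hδ hδ1
    set L := Real.log κ + Real.log (1 / δ) + Real.log d with hL
    have hL2 : 1 / 2 ≤ L := by
      have a1 : 0 ≤ Real.log κ := Real.log_nonneg hκ1
      have a2 : 0 ≤ Real.log (1 / δ) := Real.log_nonneg (by rw [le_div_iff₀ hδ]; linarith)
      have a3 : Real.log 2 ≤ Real.log d := Real.log_le_log (by norm_num) hd2
      linarith [Real.log_two_gt_d9]
    have hk := hmix δ hδ hδ1 ⌈32 * κ * L⌉₊ (Nat.le_ceil _)
    have hne : {k : ℕ | tvDist (positionLaw (quadPotential S) 0 (2 * σ) h k)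
        (biasedTarget P s 0 (2 * σ) h) ≤ δ}.Nonempty := ⟨_, hk⟩
    refine ⟨sInf _, ⟨Nat.sInf_mem hne, fun k hk' => Nat.sInf_le hk'⟩, ?_⟩
    have h2 : ((sInf {k : ℕ | tvDist (positionLaw (quadPotential S) 0 (2 * σ) h k)
        (biasedTarget P s 0 (2 * σ) h) ≤ δ} : ℕ) : ℝ) ≤ ⌈32 * κ * L⌉₊ := by
      exact_mod_cast Nat.sInf_le hk
    have h3 := Nat.ceil_lt_add_one (a := 32 * κ * L) (by positivity)
    have h4 : 1 / 2 ≤ κ * L := by nlinarith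
    rw [div_div_eq_mul_div, div_one]
    linarith
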